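/- Let $f:\{0,1\}^n\to\{0,1\}$ be a boolean function, $n\ge 2$, and let $f_\wedge:\{0,1\}^n\times\{0,1\}^n\to\{0,1\}$, $f_\wedge(x,y)=f(x\wedge y)$ (coordinatewise AND), be its corresponding AND-function. Let $C$ be the deterministic communication complexity of $f_\wedge$, i.e. the least cost (maximal number of bits exchanged) of a deterministic two-party protocol that computes $f_\wedge$, the output being determined by the transcript. An AND-decision tree is a decision tree each of whose inner nodes queries $\bigwedge_{i\in S}z_i$ for some $S\subseteq[n]$; let $\mathrm{D}_\wedge(f)$ be the least depth of an AND-decision tree computing $f$. Then $$\mathrm{D}_\wedge(f)=O(C^3\cdot\log n),$$ that is, there is an absolute constant $K>0$ such that for all $n\ge 2$ and all $f:\{0,1\}^n\to\{0,1\}$, the function $f$ is computed by an AND-decision tree of depth at most $K\cdot C^3\cdot\log_2 n$. -/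

import Mathlib

/-- A deterministic two-party communication protocol with inputs in `X` (Alice) and `Y` (Bob)
and a one-bit output: at an inner node one of the players sends a bit depending on their own
input, and a leaf carries the output. In `alice a p₀ p₁` and `bob b p₀ p₁` the play continues
in `p₀` if the bit sent is `false` and in `p₁` if it is `true`. -/
inductive Protocol (X Y : Type) : Type where
  | leaf (v : Bool) : Protocol X Y
  | alice (a : X → Bool) (p₀ p₁ : Protocol X Y) : Protocol X Y
  | bob (b : Y → Bool) (p₀ p₁ : Protocol X Y) : Protocol X Y

namespace Protocol

variable {X Y : Type}

/-- The output of the protocol on the input pair `(x, y)`. -/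
def eval : Protocol X Y → X → Y → Bool
  | leaf v, _, _ => v
  | alice a p₀ p₁, x, y => if a x = true then p₁.eval x y else p₀.eval x y
  | bob b p₀ p₁, x, y => if b y = true then p₁.eval x y else p₀.eval x y

/-- The cost of the protocol: the largest number of bits sent on a root-to-leaf path. -/
def cost : Protocol X Y → ℕ
  | leaf _ => 0
  | alice _ p₀ p₁ => max p₀.cost p₁.cost + 1
  | bob _ p₀ p₁ => max p₀.cost p₁.cost + 1

/-- The protocol outputs `F x y` on every input pair `(x, y)`. -/
def Computes (P : Protocol X Y) (F : X → Y → Bool) : Prop :=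
  ∀ x y, P.eval x y = F x y

theorem exists_computes [Finite X] (F : X → Y → Bool) :
    ∃ P : Protocol X Y, P.Computes F := by
  classical
  have := Fintype.ofFinite X
  have key : ∀ s : Finset X, ∃ P : Protocol X Y, ∀ x ∈ s, ∀ y, P.eval x y = F x y := by
    intro s
    induction s using Finset.induction_on with
    | empty => exact ⟨leaf false, by simp⟩
    | insert c s _ ih =>
      obtain ⟨P, hP⟩ := ih
      refine ⟨alice (fun x => decide (x = c)) P (bob (F c) (leaf false) (leaf true)), ?_⟩
      intro x hx y
      by_cases h : x = c
      · subst h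
        cases hF : F x y <;> simp [eval, hF]
      · have hxs : x ∈ s := by simpa [h] using hx
        simpa [eval, h] using hP x hxs y
  obtain ⟨P, hP⟩ := key Finset.univ
  exact ⟨P, fun x y => hP x (Finset.mem_univ x) y⟩

theorem exists_cost [Finite X] (F : X → Y → Bool) :
    ∃ c : ℕ, ∃ P : Protocol X Y, P.Computes F ∧ P.cost = c := by
  obtain ⟨P, hP⟩ := exists_computes F
  exact ⟨P.cost, P, hP, rfl⟩

end Protocol

open Classical in
/-- The deterministic communication complexity of `F`: the least cost of a deterministic
protocol computing `F`. -/
noncomputable def commComplexity {X Y : Type} [Finite X] (F : X → Y → Bool) : ℕ :=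
  Nat.find (Protocol.exists_cost F)

/-- An AND-decision tree over `n` boolean variables: an inner node queries the conjunction of
the variables in `S`. In `query S t₀ t₁` the computation continues in `t₀` if the conjunction
is `false` and in `t₁` if it is `true`. -/
inductive AndDecisionTree (n : ℕ) : Type where
  | leaf (v : Bool) : AndDecisionTree n
  | query (S : Finset (Fin n)) (t₀ t₁ : AndDecisionTree n) : AndDecisionTree n

namespace AndDecisionTree

variable {n : ℕ}

/-- The output of the tree on the input `z`. -/
def eval : AndDecisionTree n → (Fin n → Bool) → Bool
  | leaf v, _ => v
  | query S t₀ t₁, z => if ∀ i ∈ S, z i = true then t₁.eval z else t₀.eval z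

/-- The depth of the tree: the largest number of queries on a root-to-leaf path. -/
def depth : AndDecisionTree n → ℕ
  | leaf _ => 0
  | query _ t₀ t₁ => max t₀.depth t₁.depth + 1

/-- The tree outputs `f z` on every input `z`. -/
def Computes (T : AndDecisionTree n) (f : (Fin n → Bool) → Bool) : Prop :=
  ∀ z, T.eval z = f z

theorem exists_computes (f : (Fin n → Bool) → Bool) :
    ∃ T : AndDecisionTree n, T.Computes f := by
  classical
  have key : ∀ (s : Finset (Fin n)) (g : (Fin n → Bool) → Bool),
      (∀ z w : Fin n → Bool, (∀ i ∈ s, z i = w i) → g z = g w) →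
      ∃ T : AndDecisionTree n, ∀ z, T.eval z = g z := by
    intro s
    induction s using Finset.induction_on with
    | empty =>
      intro g hg
      exact ⟨leaf (g fun _ => false), fun z => hg _ _ (by simp)⟩
    | insert j s _ ih =>
      intro g hg
      have sub : ∀ b : Bool, ∃ T : AndDecisionTree n,
          ∀ z, T.eval z = g (Function.update z j b) := by
        intro b
        refine ih (fun z => g (Function.update z j b)) ?_
        intro z w h
        refine hg _ _ fun i hi => ?_
        by_cases hij : i = j
        · subst hij; simp
        · have his : i ∈ s := by simpa [hij] using hi
          simpa [hij] using h i his
      obtain ⟨T₀, h₀⟩ := sub false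
      obtain ⟨T₁, h₁⟩ := sub true
      refine ⟨query {j} T₀ T₁, fun z => ?_⟩
      cases hz : z j
      · have : Function.update z j false = z := by rw [← hz]; simp
        simp [eval, hz, h₀, this]
      · have : Function.update z j true = z := by rw [← hz]; simp
        simp [eval, hz, h₁, this]
  exact key Finset.univ f fun z w h => congrArg f (funext fun i => h i (Finset.mem_univ i))

theorem exists_depth (f : (Fin n → Bool) → Bool) :
    ∃ d : ℕ, ∃ T : AndDecisionTree n, T.Computes f ∧ T.depth = d := by
  obtain ⟨T, hT⟩ := exists_computes f
  exact ⟨T.depth, T, hT, rfl⟩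

end AndDecisionTree

open Classical in
/-- The AND-decision tree complexity of `f`: the least depth of an AND-decision tree
computing `f`. -/
noncomputable def andDTComplexity {n : ℕ} (f : (Fin n → Bool) → Bool) : ℕ :=
  Nat.find (AndDecisionTree.exists_depth f)

/-- The AND-function of `f`: `(x, y) ↦ f (x ∧ y)`, with the coordinatewise conjunction. -/
def andFunction {n : ℕ} (f : (Fin n → Bool) → Bool) :
    (Fin n → Bool) → (Fin n → Bool) → Bool :=
  fun x y => f (fun i => x i && y i)

/-! Identify inputs with subsets of `[n]`, so that `f` becomes a set function `g`, expanded as a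
real multilinear polynomial. Two consequences of a cost-`C` protocol carry the proof.

Few monomials: the matrix of `g (x ∩ y)` is `Z * diagonal a * Zᵀ` with `Z` the invertible inclusion
matrix, so its rank is the number of nonzero coefficients. A protocol bounds this rank by `2 ^ C`
(`HasAndCost.card_monomials_le`).

A popular variable: disjoint blocks sensitive at one base point embed unique disjointness, so there
are at most `2 * C` of them (`HasAndCost.card_le_of_sensitive`). A sampling argument extends this to
fractional packings, with weight at most `L = O(C ^ 2)` (`fracPackingBound_of_card_le`). Every
nonempty monomial contains a block sensitive at `∅`. Giving each of these blocks the same weight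
shows that some variable lies in a fraction `1 / L` of the monomials (`HasAndCost.exists_popular`).

The tree follows the chain that repeatedly sets the currently popular variable to one, and finds its
first zero by binary search with `O(log n)` queries. Setting variables to one creates no new
monomials, and the zero kills a fraction `1 / L` of those left. From `2 ^ C` monomials, `O(C * L) =
O(C ^ 3)` rounds leave a constant. -/

/-! ### Protocols under substitution of inputs -/

namespace Protocol

variable {X Y X' Y' : Type}

/-- Precompose the two inputs of a protocol. -/
def comap (φ : X' → X) (ψ : Y' → Y) : Protocol X Y → Protocol X' Y'
  | leaf v => leaf v
  | alice a p₀ p₁ => alice (a ∘ φ) (p₀.comap φ ψ) (p₁.comap φ ψ)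
  | bob b p₀ p₁ => bob (b ∘ ψ) (p₀.comap φ ψ) (p₁.comap φ ψ)

theorem cost_comap (φ : X' → X) (ψ : Y' → Y) (P : Protocol X Y) :
    (P.comap φ ψ).cost = P.cost := by
  induction P <;> simp_all [comap, cost]

theorem eval_comap (φ : X' → X) (ψ : Y' → Y) (P : Protocol X Y) (x : X') (y : Y') :
    (P.comap φ ψ).eval x y = P.eval (φ x) (ψ y) := by
  induction P <;> simp_all [comap, eval]

end Protocol

/-- The AND-function `(x, y) ↦ g (x ∩ y)` of the set function `g` has a protocol of cost at
most `C`. -/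
def HasAndCost {α : Type} [DecidableEq α] (g : Finset α → Bool) (C : ℕ) : Prop :=
  ∃ P : Protocol (Finset α) (Finset α), P.cost ≤ C ∧ P.Computes fun x y => g (x ∩ y)

/-- Each player applies `φ` locally. This covers both the restrictions of `g` and the reduction from
disjointness. -/
theorem HasAndCost.comp {α β : Type} [DecidableEq α] [DecidableEq β] {g : Finset α → Bool}
    {C : ℕ} (h : HasAndCost g C) (φ : Finset β → Finset α)
    (hφ : ∀ x y, φ (x ∩ y) = φ x ∩ φ y) : HasAndCost (g ∘ φ) C := by
  obtain ⟨P, hP, hc⟩ := h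
  refine ⟨P.comap φ φ, by rwa [Protocol.cost_comap], fun x y => ?_⟩
  rw [Protocol.eval_comap, hc (φ x) (φ y)]
  exact congrArg g (hφ x y).symm

/-! ### Unique disjointness and disjoint sensitive blocks -/

section Disjointness

variable {ι : Type} [DecidableEq ι]

open Classical in
/-- The number of disjoint pairs of subsets of `G` in the rectangle `A × B`. -/
noncomputable def disjCount (G : Finset ι) (A B : Finset ι → Prop) : ℕ :=
  ∑ u ∈ G.powerset, ∑ v ∈ G.powerset, if A u ∧ B v ∧ Disjoint u v then 1 else 0

open Classical in
theorem disjCount_insert {i : ι} {G : Finset ι} (hi : i ∉ G) (A B : Finset ι → Prop) :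
    disjCount (insert i G) A B = disjCount G A B + disjCount G (fun u => A (insert i u)) B
      + disjCount G A (fun v => B (insert i v)) := by
  unfold disjCount
  simp only [Finset.sum_powerset_insert hi, ← Finset.sum_add_distrib]
  refine Finset.sum_congr rfl fun u hu => Finset.sum_congr rfl fun v hv => ?_
  have hiu : i ∉ u := fun h => hi (Finset.mem_powerset.1 hu h)
  have hiv : i ∉ v := fun h => hi (Finset.mem_powerset.1 hv h)
  simp only [Finset.disjoint_insert_left, Finset.disjoint_insert_right, hiu, hiv,
    Finset.mem_insert, not_false_eq_true, true_and, true_or, not_true_eq_false, false_and, and_false,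
    if_false, add_zero]
  omega

/-- A rectangle without uniquely intersecting pairs has few disjoint pairs. -/
theorem disjCount_le_two_pow (G : Finset ι) : ∀ A B : Finset ι → Prop,
    (∀ u v, u ⊆ G → v ⊆ G → A u → B v → (u ∩ v).card ≠ 1) →
      disjCount G A B ≤ 2 ^ G.card := by
  classical
  induction G using Finset.induction_on with
  | empty =>
    intro A B _
    simp only [disjCount, Finset.powerset_empty, Finset.sum_singleton]
    split_ifs <;> simp
  | insert i G hi ih =>
    intro A B h
    have sub : ∀ {w : Finset ι}, w ⊆ G → w ⊆ insert i G := fun hw =>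
      hw.trans (Finset.subset_insert _ _)
    -- Forget `i` on one side only: if just one player's set contains `i`, the intersection is
    -- unchanged, so the hypothesis descends to `G`.
    have h₁ := ih (fun u => A u ∨ A (insert i u)) B (by
      rintro u v hu hv (ha | ha) hb
      · exact h u v (sub hu) (sub hv) ha hb
      · have := h (insert i u) v (Finset.insert_subset_insert i hu) (sub hv) ha hb
        rwa [Finset.insert_inter_of_notMem fun hv' => hi (hv hv')] at this)
    have h₂ := ih A (fun v => B v ∨ B (insert i v)) (by
      rintro u v hu hv ha (hb | hb)
      · exact h u v (sub hu) (sub hv) ha hb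
      · have := h u (insert i v) (sub hu) (Finset.insert_subset_insert i hv) ha hb
        rwa [Finset.inter_insert_of_notMem fun hv' => hi (hu hv')] at this)
    rw [Finset.card_insert_of_notMem hi, pow_succ, mul_two, disjCount_insert hi]
    refine le_trans ?_ (add_le_add h₁ h₂)
    unfold disjCount
    simp only [← Finset.sum_add_distrib]
    refine Finset.sum_le_sum fun u hu => Finset.sum_le_sum fun v hv => ?_
    rw [Finset.mem_powerset] at hu hv
    by_cases hd : Disjoint u v
    · have h₁₁ : ¬(A (insert i u) ∧ B (insert i v)) := by
        rintro ⟨ha, hb⟩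
        refine h _ _ (Finset.insert_subset_insert i hu) (Finset.insert_subset_insert i hv) ha hb ?_
        rw [← Finset.insert_inter_distrib, Finset.disjoint_iff_inter_eq_empty.1 hd]
        simp
      simp only [hd, and_true]
      clear h h₁ h₂ ih
      generalize A u = a₀, A (insert i u) = a₁, B v = b₀, B (insert i v) = b₁ at h₁₁ ⊢
      by_cases a₀ <;> by_cases a₁ <;> by_cases b₀ <;> by_cases b₁ <;> simp_all
    · simp [hd]

theorem disjCount_univ (G : Finset ι) : disjCount G (fun _ => True) (fun _ => True) = 3 ^ G.card := by
  induction G using Finset.induction_on with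
  | empty => simp [disjCount]
  | insert i G hi ih => rw [disjCount_insert hi, ih, Finset.card_insert_of_notMem hi]; ring

theorem disjCount_le_add (G : Finset ι) {A A₁ A₂ B B₁ B₂ : Finset ι → Prop}
    (h : ∀ u v, A u → B v → (A₁ u ∧ B₁ v) ∨ (A₂ u ∧ B₂ v)) :
    disjCount G A B ≤ disjCount G A₁ B₁ + disjCount G A₂ B₂ := by
  classical
  unfold disjCount
  simp only [← Finset.sum_add_distrib]
  refine Finset.sum_le_sum fun u _ => Finset.sum_le_sum fun v _ => ?_
  have := h u v
  split_ifs <;> first | omega | tauto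

/-- The leaves cut the rectangle into at most `2 ^ P.cost` rectangles. One labelled `c` has no
uniquely intersecting pair, hence at most `2 ^ G.card` disjoint pairs; any other has no disjoint
pair at all. -/
theorem disjCount_le_of_protocol (G : Finset ι) (c : Bool)
    (P : Protocol (Finset ι) (Finset ι)) : ∀ A B : Finset ι → Prop,
    (∀ u v, u ⊆ G → v ⊆ G → A u → B v → Disjoint u v → P.eval u v = c) →
    (∀ u v, u ⊆ G → v ⊆ G → A u → B v → (u ∩ v).card = 1 → P.eval u v ≠ c) →
      disjCount G A B ≤ 2 ^ P.cost * 2 ^ G.card := by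
  classical
  induction P with
  | leaf b =>
    intro A B h₀ h₁
    simp only [Protocol.eval] at h₀ h₁
    by_cases hb : b = c
    · simpa [Protocol.cost] using disjCount_le_two_pow G A B
        fun u v hu hv ha hb' h => h₁ u v hu hv ha hb' h hb
    · have : disjCount G A B = 0 := by
        unfold disjCount
        refine Finset.sum_eq_zero fun u hu => Finset.sum_eq_zero fun v hv => if_neg ?_
        rintro ⟨ha, hb', hd⟩
        exact hb (h₀ u v (Finset.mem_powerset.1 hu) (Finset.mem_powerset.1 hv) ha hb' hd)
      simp [this]
  | alice a p₀ p₁ ih₀ ih₁ =>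
    intro A B h₀ h₁
    simp only [Protocol.eval] at h₀ h₁
    have e₀ := ih₀ (fun u => A u ∧ a u = false) B
      (fun u v hu hv ha hb hd => by simpa [ha.2] using h₀ u v hu hv ha.1 hb hd)
      (fun u v hu hv ha hb hd => by simpa [ha.2] using h₁ u v hu hv ha.1 hb hd)
    have e₁ := ih₁ (fun u => A u ∧ a u = true) B
      (fun u v hu hv ha hb hd => by simpa [ha.2] using h₀ u v hu hv ha.1 hb hd)
      (fun u v hu hv ha hb hd => by simpa [ha.2] using h₁ u v hu hv ha.1 hb hd)
    have e := disjCount_le_add G (A := A) (B := B) (A₁ := fun u => A u ∧ a u = false) (B₁ := B)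
      (A₂ := fun u => A u ∧ a u = true) (B₂ := B)
      (fun u v ha hb => by cases a u <;> simp [ha, hb])
    have m₀ := Nat.pow_le_pow_right (n := 2) (by norm_num) (le_max_left p₀.cost p₁.cost)
    have m₁ := Nat.pow_le_pow_right (n := 2) (by norm_num) (le_max_right p₀.cost p₁.cost)
    rw [Protocol.cost, pow_succ]
    nlinarith [Nat.mul_le_mul_right (2 ^ G.card) m₀, Nat.mul_le_mul_right (2 ^ G.card) m₁]
  | bob b p₀ p₁ ih₀ ih₁ =>
    intro A B h₀ h₁
    simp only [Protocol.eval] at h₀ h₁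
    have e₀ := ih₀ A (fun v => B v ∧ b v = false)
      (fun u v hu hv ha hb hd => by simpa [hb.2] using h₀ u v hu hv ha hb.1 hd)
      (fun u v hu hv ha hb hd => by simpa [hb.2] using h₁ u v hu hv ha hb.1 hd)
    have e₁ := ih₁ A (fun v => B v ∧ b v = true)
      (fun u v hu hv ha hb hd => by simpa [hb.2] using h₀ u v hu hv ha hb.1 hd)
      (fun u v hu hv ha hb hd => by simpa [hb.2] using h₁ u v hu hv ha hb.1 hd)
    have e := disjCount_le_add G (A := A) (B := B) (A₁ := A) (B₁ := fun v => B v ∧ b v = false)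
      (A₂ := A) (B₂ := fun v => B v ∧ b v = true)
      (fun u v ha hb => by cases b v <;> simp [ha, hb])
    have m₀ := Nat.pow_le_pow_right (n := 2) (by norm_num) (le_max_left p₀.cost p₁.cost)
    have m₁ := Nat.pow_le_pow_right (n := 2) (by norm_num) (le_max_right p₀.cost p₁.cost)
    rw [Protocol.cost, pow_succ]
    nlinarith [Nat.mul_le_mul_right (2 ^ G.card) m₀, Nat.mul_le_mul_right (2 ^ G.card) m₁]

end Disjointness

/-- Disjoint blocks sensitive at a common base point number at most twice the communication
cost. -/
theorem HasAndCost.card_le_of_sensitive {α ι : Type} [DecidableEq α] [DecidableEq ι]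
    {g : Finset α → Bool} {C : ℕ} (h : HasAndCost g C) (y : Finset α) (G : Finset ι)
    (B : ι → Finset α) (hB : ∀ i ∈ G, ∀ j ∈ G, i ≠ j → Disjoint (B i) (B j))
    (hs : ∀ i ∈ G, g (y ∪ B i) ≠ g y) : G.card ≤ 2 * C := by
  -- Disjointness of the blocks makes this encoding preserve intersections. Disjoint pairs then give
  -- `g y`, and pairs meeting in one index give the opposite value.
  obtain ⟨P, hP, hc⟩ := h.comp (β := ι) (fun u => y ∪ (u ∩ G).biUnion B) (by
    intro u v
    ext e
    simp only [Finset.mem_union, Finset.mem_biUnion, Finset.mem_inter]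
    constructor
    · rintro (he | ⟨i, ⟨⟨hu, hv⟩, hG⟩, he⟩)
      · exact ⟨Or.inl he, Or.inl he⟩
      · exact ⟨Or.inr ⟨i, ⟨hu, hG⟩, he⟩, Or.inr ⟨i, ⟨hv, hG⟩, he⟩⟩
    · rintro ⟨he | ⟨i, ⟨hu, hG⟩, he⟩, he' | ⟨j, ⟨hv, hG'⟩, he'⟩⟩
      · exact Or.inl he
      · exact Or.inl he
      · exact Or.inl he'
      · by_cases hij : i = j
        · subst hij
          exact Or.inr ⟨i, ⟨⟨hu, hv⟩, hG⟩, he⟩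
        · exact absurd he' (Finset.disjoint_left.1 (hB i hG j hG' hij) he))
  have key := disjCount_le_of_protocol G (g y) P (fun _ => True) (fun _ => True)
    (fun u v _ _ _ _ hd => by
      rw [hc u v]
      simp [Finset.disjoint_iff_inter_eq_empty.1 hd])
    (fun u v hu _ _ _ h₁ => by
      obtain ⟨i, hi⟩ := Finset.card_eq_one.1 h₁
      have hiG : i ∈ G := hu (Finset.mem_of_mem_inter_left (hi ▸ Finset.mem_singleton_self i))
      rw [hc u v]
      simpa [hi, Finset.singleton_inter_of_mem hiG] using hs i hiG)
  -- Now `3 ^ k ≤ 2 ^ C * 2 ^ k`. Squaring it under `2 * C < k` would give `9 ^ k ≤ 8 ^ k`.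
  rw [disjCount_univ] at key
  by_contra! hlt
  set k := G.card with hk
  have h₁ : 3 ^ k ≤ 2 ^ C * 2 ^ k :=
    key.trans (Nat.mul_le_mul_right _ (Nat.pow_le_pow_right (by norm_num) hP))
  have h₂ : 9 ^ k ≤ 2 ^ (2 * C) * 4 ^ k := by
    have := Nat.mul_le_mul h₁ h₁
    calc 9 ^ k = 3 ^ k * 3 ^ k := by rw [← mul_pow]; norm_num
      _ ≤ _ := this
      _ = 2 ^ (2 * C) * 4 ^ k := by
        rw [show 4 = 2 * 2 from rfl, mul_pow]
        ring
  have h₃ : 2 ^ (2 * C) * 4 ^ k ≤ 2 ^ k * 4 ^ k :=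
    Nat.mul_le_mul_right _ (Nat.pow_le_pow_right (by norm_num) hlt.le)
  have h₄ : 2 ^ k * 4 ^ k = 8 ^ k := by rw [← mul_pow]; norm_num
  have h₅ : 8 ^ k < 9 ^ k := Nat.pow_lt_pow_left (by norm_num) (by omega)
  omega

/-! ### From integral to fractional packings of sensitive blocks -/

section Sampling

variable {α : Type} [DecidableEq α]

/-- The union of the pairwise intersections of the blocks indexed by `T`. -/
def pairUnion {ι : Type} [DecidableEq ι] (T : Finset ι) (ω : ι → Finset α) : Finset α :=
  T.offDiag.biUnion fun q => ω q.1 ∩ ω q.2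

theorem mem_pairUnion {ι : Type} [DecidableEq ι] {T : Finset ι} {ω : ι → Finset α} {e : α} :
    e ∈ pairUnion T ω ↔ ∃ i ∈ T, ∃ j ∈ T, i ≠ j ∧ e ∈ ω i ∧ e ∈ ω j := by
  simp only [pairUnion, Finset.mem_biUnion, Finset.mem_offDiag, Finset.mem_inter, Prod.exists]
  constructor
  · rintro ⟨i, j, ⟨hi, hj, hij⟩, h₁, h₂⟩
    exact ⟨i, hi, j, hj, hij, h₁, h₂⟩
  · rintro ⟨i, hi, j, hj, hij, h₁, h₂⟩
    exact ⟨i, j, ⟨hi, hj, hij⟩, h₁, h₂⟩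

variable [Fintype α]

/-- Bounds the total weight of every fractional packing of blocks that are sensitive for `g` at
a common base point: a family of blocks with weights whose coverage of each point is at
most `c` has sensitive blocks of total weight at most `L * c`. -/
def FracPackingBound (g : Finset α → Bool) (L : ℝ) : Prop :=
  ∀ (y : Finset α) (μ : Finset α → ℝ), (∀ B, 0 ≤ μ B) → (∀ B, μ B ≠ 0 → g (y ∪ B) ≠ g y) →
    (∀ e, ∑ B, (if e ∈ B then μ B else 0) ≤ 1) → ∑ B, μ B ≤ L

/-- Used as a probability bound: a random block that covers each point with probability at most `c`
is sensitive with probability at most `L * c`. The proof pushes `w` forward to blocks, keeps the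
sensitive ones and rescales by `c`. -/
theorem FracPackingBound.sum_le {g : Finset α → Bool} {L : ℝ} (h : FracPackingBound g L)
    {Ω : Type} [Fintype Ω] (y : Finset α) (w : Ω → ℝ) (hw : ∀ ω, 0 ≤ w ω) (B : Ω → Finset α)
    {c : ℝ} (hc : 0 < c) (hcov : ∀ e, ∑ ω, (if e ∈ B ω then w ω else 0) ≤ c) :
    ∑ ω, (if g (y ∪ B ω) ≠ g y then w ω else 0) ≤ L * c := by
  classical
  have key := h y (fun b => (∑ ω, if B ω = b ∧ g (y ∪ b) ≠ g y then w ω else 0) / c)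
    (fun b => div_nonneg (Finset.sum_nonneg fun ω _ => by split_ifs <;> simp [hw]) hc.le)
    (fun b hb hg => hb (by simp [hg]))
    (fun e => by
      calc ∑ b : Finset α, (if e ∈ b then
            (∑ ω, if B ω = b ∧ g (y ∪ b) ≠ g y then w ω else 0) / c else 0)
          ≤ ∑ b : Finset α, (∑ ω, if B ω = b then (if e ∈ B ω then w ω else 0) else 0) / c := by
            refine Finset.sum_le_sum fun b _ => ?_
            split_ifs with he
            · refine div_le_div_of_nonneg_right (Finset.sum_le_sum fun ω _ => ?_) hc.le
              by_cases hb : B ω = b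
              · subst hb
                simp only [true_and, he, if_true]
                split_ifs <;> simp [hw]
              · simp [hb]
            · refine div_nonneg (Finset.sum_nonneg fun ω _ => ?_) hc.le
              split_ifs <;> simp [hw]
        _ = (∑ ω, if e ∈ B ω then w ω else 0) / c := by
            rw [← Finset.sum_div, Finset.sum_comm]
            simp
        _ ≤ 1 := (div_le_one hc).2 (hcov e))
  rw [← Finset.sum_div, div_le_iff₀ hc, Finset.sum_comm] at key
  refine le_trans (le_of_eq (Finset.sum_congr rfl fun ω _ => ?_)) key
  rw [Finset.sum_eq_single (B ω)]
  · simp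
  · intro b _ hb
    simp [hb.symm]
  · simp

/-- A union bound over pairs of independent blocks. Coordinates outside `T` need not be normalised;
their mass `m` lets one coordinate be conditioned on a fixed block. -/
theorem sum_prod_mem_pairUnion_le {ι : Type} [Fintype ι] [DecidableEq ι] (T : Finset ι)
    (ν : ι → Finset α → ℝ) (hν : ∀ i B, 0 ≤ ν i B) {p m : ℝ}
    (hmass : ∀ i ∈ T, ∑ B, ν i B = 1) (hm : ∏ i ∈ Tᶜ, ∑ B, ν i B = m)
    (e : α) (hcov : ∀ i ∈ T, ∑ B, (if e ∈ B then ν i B else 0) ≤ p) :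
    ∑ ω : ι → Finset α, (if e ∈ pairUnion T ω then ∏ i, ν i (ω i) else 0)
      ≤ (Fintype.card ι : ℝ) ^ 2 * p ^ 2 * m := by
  have hm0 : 0 ≤ m := hm ▸ Finset.prod_nonneg fun i _ => Finset.sum_nonneg fun B _ => hν i B
  have hW : ∀ ω : ι → Finset α, 0 ≤ ∏ i, ν i (ω i) := fun ω =>
    Finset.prod_nonneg fun i _ => hν i _
  have pair : ∀ q ∈ T.offDiag, ∑ ω : ι → Finset α,
      (if e ∈ ω q.1 ∩ ω q.2 then ∏ i, ν i (ω i) else 0) ≤ p ^ 2 * m := by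
    rintro ⟨j, l⟩ hq
    obtain ⟨hj, hl, hjl⟩ := Finset.mem_offDiag.1 hq
    simp only at hj hl hjl
    -- Absorbing the indicator into the factors lets the sum over `ω` split coordinatewise.
    have rewrite : ∀ ω : ι → Finset α, (if e ∈ ω j ∩ ω l then ∏ i, ν i (ω i) else 0)
        = ∏ i, (if (i = j ∨ i = l) ∧ e ∉ ω i then 0 else ν i (ω i)) := by
      intro ω
      split_ifs with h
      · rw [Finset.mem_inter] at h
        refine Finset.prod_congr rfl fun i _ => ?_
        rw [if_neg]
        rintro ⟨rfl | rfl, h'⟩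
        · exact h' h.1
        · exact h' h.2
      · rw [Finset.mem_inter, not_and_or] at h
        rcases h with h | h
        · exact (Finset.prod_eq_zero (Finset.mem_univ j) (by simp [h])).symm
        · exact (Finset.prod_eq_zero (Finset.mem_univ l) (by simp [h])).symm
    simp only [rewrite]
    rw [← Fintype.prod_sum (fun i B => if (i = j ∨ i = l) ∧ e ∉ B then 0 else ν i B),
      ← Finset.prod_mul_prod_compl T]
    have hcompl : ∏ i ∈ Tᶜ, ∑ B, (if (i = j ∨ i = l) ∧ e ∉ B then 0 else ν i B) = m := by
      rw [← hm]
      refine Finset.prod_congr rfl fun i hi => Finset.sum_congr rfl fun B _ => if_neg ?_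
      rintro ⟨rfl | rfl, -⟩
      · exact Finset.mem_compl.1 hi hj
      · exact Finset.mem_compl.1 hi hl
    rw [hcompl]
    refine mul_le_mul_of_nonneg_right ?_ hm0
    have hbound : ∀ i ∈ T, ∑ B, (if (i = j ∨ i = l) ∧ e ∉ B then 0 else ν i B)
        ≤ if i = j ∨ i = l then p else 1 := by
      intro i hi
      by_cases h : i = j ∨ i = l
      · rw [if_pos h]
        refine le_trans (le_of_eq (Finset.sum_congr rfl fun B _ => ?_)) (hcov i hi)
        by_cases hB : e ∈ B <;> simp [h, hB]
      · simp [h, hmass i hi]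
    refine (Finset.prod_le_prod (fun i _ => Finset.sum_nonneg fun B _ => ?_) hbound).trans ?_
    · split_ifs <;> simp [hν]
    · rw [← Finset.prod_filter]
      have : T.filter (fun i => i = j ∨ i = l) = {j, l} := by
        ext i
        simp only [Finset.mem_filter, Finset.mem_insert, Finset.mem_singleton]
        constructor
        · exact fun h => h.2
        · rintro (rfl | rfl)
          · exact ⟨hj, Or.inl rfl⟩
          · exact ⟨hl, Or.inr rfl⟩
      rw [this, Finset.prod_pair hjl, sq]
  calc ∑ ω : ι → Finset α, (if e ∈ pairUnion T ω then ∏ i, ν i (ω i) else 0)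
      ≤ ∑ ω : ι → Finset α, ∑ q ∈ T.offDiag,
          (if e ∈ ω q.1 ∩ ω q.2 then ∏ i, ν i (ω i) else 0) := by
        refine Finset.sum_le_sum fun ω _ => ?_
        have hnn : ∀ q ∈ T.offDiag,
            0 ≤ if e ∈ ω q.1 ∩ ω q.2 then ∏ i, ν i (ω i) else (0 : ℝ) := fun q _ => by
          split_ifs <;> simp [hW]
        split_ifs with h
        · obtain ⟨q, hq, he⟩ := Finset.mem_biUnion.1 h
          refine le_trans ?_ (Finset.single_le_sum hnn hq)
          rw [if_pos he]
        · exact Finset.sum_nonneg hnn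
    _ = ∑ q ∈ T.offDiag, ∑ ω : ι → Finset α,
          (if e ∈ ω q.1 ∩ ω q.2 then ∏ i, ν i (ω i) else 0) := Finset.sum_comm
    _ ≤ ∑ q ∈ T.offDiag, p ^ 2 * m := Finset.sum_le_sum pair
    _ ≤ (Fintype.card ι : ℝ) ^ 2 * p ^ 2 * m := by
        rw [Finset.sum_const, nsmul_eq_mul, mul_assoc]
        refine mul_le_mul_of_nonneg_right ?_ (by positivity)
        have h₁ : T.offDiag.card ≤ Fintype.card ι ^ 2 := by
          rw [Finset.offDiag_card, sq]
          exact (Nat.sub_le _ _).trans (Nat.mul_le_mul (Finset.card_le_univ _) (Finset.card_le_univ _))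
        exact_mod_cast h₁

/-- If disjoint sensitive blocks at any base point number at most `m`, then a fractional
packing which is optimal up to a factor of two has weight less than `8 * (2 * m + 1) ^ 2`. -/
theorem lt_of_near_optimal {g : Finset α → Bool} {m : ℕ}
    (hm : ∀ (y : Finset α) (G : Finset (Fin (2 * m + 1))) (B : Fin (2 * m + 1) → Finset α),
      (∀ i ∈ G, ∀ j ∈ G, i ≠ j → Disjoint (B i) (B j)) → (∀ i ∈ G, g (y ∪ B i) ≠ g y) →
        G.card ≤ m)
    {M : ℝ} (hM : 0 < M) (hopt : FracPackingBound g (2 * M)) (z : Finset α)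
    (μ : Finset α → ℝ) (hμ : ∀ B, 0 ≤ μ B) (hsens : ∀ B, μ B ≠ 0 → g (z ∪ B) ≠ g z)
    (hcov : ∀ e, ∑ B, (if e ∈ B then μ B else 0) ≤ 1) (hmass : ∑ B, μ B = M) :
    M < 8 * (2 * m + 1) ^ 2 := by
  classical
  by_contra! hlarge
  -- Sample `k` independent blocks from `μ / M`. If at most `k / 2` of them are bad, then at most
  -- `m` are, and `m + 1` good ones contradict `hm`.
  set k := 2 * m + 1 with hk
  have hkR : ((k : ℕ) : ℝ) = 2 * m + 1 := by rw [hk]; push_cast; ring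
  have hk0 : (0 : ℝ) < k := by rw [hkR]; positivity
  rw [← hkR] at hlarge
  obtain ⟨ν, hν⟩ : ∃ ν : Finset α → ℝ, ν = fun B => μ B / M := ⟨_, rfl⟩
  have hν0 : ∀ B, 0 ≤ ν B := fun B => by rw [hν]; exact div_nonneg (hμ B) hM.le
  have hν1 : ∑ B, ν B = 1 := by rw [hν, ← Finset.sum_div, hmass, div_self hM.ne']
  have hνcov : ∀ e, ∑ B, (if e ∈ B then ν B else 0) ≤ 1 / M := by
    intro e
    refine le_trans (le_of_eq ?_) (div_le_div_of_nonneg_right (hcov e) hM.le)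
    rw [Finset.sum_div, hν]
    exact Finset.sum_congr rfl fun B _ => by split_ifs <;> simp
  have hνs : ∀ B, ν B ≠ 0 → g (z ∪ B) ≠ g z := fun B hB => hsens B fun h => hB (by simp [hν, h])
  obtain ⟨W, hWdef⟩ : ∃ W : (Fin k → Finset α) → ℝ, W = fun ω => ∏ i, ν (ω i) := ⟨_, rfl⟩
  have hW0 : ∀ ω, 0 ≤ W ω := fun ω => by
    rw [hWdef]; exact Finset.prod_nonneg fun i _ => hν0 _
  have hW1 : ∑ ω, W ω = 1 := by
    rw [hWdef, ← Fintype.prod_sum (fun (_ : Fin k) B => ν B)]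
    simp [hν1]
  -- A point is covered twice with probability at most `k ^ 2 / M ^ 2`; the packing bound `2 * M`
  -- turns this into `2 * k ^ 2 / M`.
  have base : ∑ ω, (if g (z ∪ pairUnion Finset.univ ω) ≠ g z then W ω else 0)
      ≤ 2 * k ^ 2 / M := by
    have := hopt.sum_le z W hW0 (fun ω => pairUnion Finset.univ ω)
      (c := k ^ 2 * (1 / M) ^ 2) (by positivity) (fun e => by
        have := sum_prod_mem_pairUnion_le (Finset.univ : Finset (Fin k)) (fun _ => ν)
          (fun _ => hν0) (fun _ _ => hν1) (m := 1) (by simp) e (fun _ _ => hνcov e)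
        simpa [hWdef] using this)
    refine this.trans (le_of_eq ?_)
    field_simp
  have shifted : ∀ i : Fin k, ∑ ω, (if g (z ∪ ω i ∪ pairUnion (Finset.univ.erase i) ω)
      ≠ g (z ∪ ω i) then W ω else 0) ≤ 2 * k ^ 2 / M := by
    intro i
    -- Given `ω i = b`, the other blocks stay independent, so the packing bound applies at the new
    -- base point `z ∪ b`.
    have fixed : ∀ b : Finset α, ∑ ω : Fin k → Finset α, (if g (z ∪ b ∪
        pairUnion (Finset.univ.erase i) ω) ≠ g (z ∪ b) then (if ω i = b then W ω else 0) else 0)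
          ≤ 2 * k ^ 2 / M * ν b := by
      intro b
      rcases (hν0 b).eq_or_lt with hb | hb
      · rw [← hb, mul_zero]
        refine Finset.sum_nonpos fun ω _ => ?_
        split_ifs with h₁ h₂
        · rw [hWdef]
          exact (Finset.prod_eq_zero (Finset.mem_univ i) (by rw [h₂, ← hb])).le
        · exact le_rfl
        · exact le_rfl
      · have hprod : ∀ ω : Fin k → Finset α, (if ω i = b then W ω else 0)
            = ∏ j, (if j = i ∧ ω j ≠ b then 0 else ν (ω j)) := by
          intro ω
          split_ifs with h
          · rw [hWdef]
            refine Finset.prod_congr rfl fun j _ => ?_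
            rw [if_neg]
            rintro ⟨rfl, hj⟩
            exact hj h
          · exact (Finset.prod_eq_zero (Finset.mem_univ i) (by simp [h])).symm
        have := hopt.sum_le (z ∪ b) (fun ω : Fin k → Finset α => if ω i = b then W ω else 0)
          (fun ω => by split_ifs <;> simp [hW0]) (fun ω => pairUnion (Finset.univ.erase i) ω)
          (c := k ^ 2 * (1 / M) ^ 2 * ν b) (by positivity) (fun e => by
            have := sum_prod_mem_pairUnion_le (Finset.univ.erase i)
              (fun j B => if j = i ∧ B ≠ b then 0 else ν B)
              (fun j B => by split_ifs <;> simp [hν0])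
              (fun j hj => by simp [Finset.ne_of_mem_erase hj, hν1]) (m := ν b)
              (by
                have : (Finset.univ.erase i)ᶜ = {i} := by ext; simp
                rw [this, Finset.prod_singleton, Finset.sum_eq_single b]
                · simp
                · intro B _ hB; simp [hB]
                · simp) e
              (fun j hj => by simpa [Finset.ne_of_mem_erase hj] using hνcov e)
            simpa [hprod] using this)
        refine this.trans (le_of_eq ?_)
        field_simp
    calc ∑ ω, (if g (z ∪ ω i ∪ pairUnion (Finset.univ.erase i) ω) ≠ g (z ∪ ω i) then W ω else 0)
        = ∑ b : Finset α, ∑ ω : Fin k → Finset α, (if g (z ∪ b ∪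
            pairUnion (Finset.univ.erase i) ω) ≠ g (z ∪ b) then (if ω i = b then W ω else 0)
              else 0) := by
          rw [Finset.sum_comm]
          refine Finset.sum_congr rfl fun ω _ => ?_
          rw [Finset.sum_eq_single (ω i)]
          · simp
          · intro b _ hb; simp [hb.symm]
          · simp
      _ ≤ ∑ b : Finset α, 2 * k ^ 2 / M * ν b := Finset.sum_le_sum fun b _ => fixed b
      _ = 2 * k ^ 2 / M := by rw [← Finset.mul_sum, hν1, mul_one]
  let bad : (Fin k → Finset α) → Finset (Fin k) := fun ω => Finset.univ.filter fun i =>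
    g (z ∪ ω i ∪ pairUnion (Finset.univ.erase i) ω) ≠ g (z ∪ ω i)
  -- The weight `k` on a base failure exceeds the average `k / 2`, so an outcome no worse than
  -- average has no base failure.
  have expect : ∑ ω, W ω * ((bad ω).card +
      k * (if g (z ∪ pairUnion Finset.univ ω) ≠ g z then 1 else 0)) ≤ k / 2 := by
    have : ∑ ω, W ω * ((bad ω).card +
        k * (if g (z ∪ pairUnion Finset.univ ω) ≠ g z then 1 else 0))
        = ∑ i : Fin k, ∑ ω, (if g (z ∪ ω i ∪ pairUnion (Finset.univ.erase i) ω)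
          ≠ g (z ∪ ω i) then W ω else 0)
        + k * ∑ ω, (if g (z ∪ pairUnion Finset.univ ω) ≠ g z then W ω else 0) := by
      rw [Finset.sum_comm, Finset.mul_sum, ← Finset.sum_add_distrib]
      refine Finset.sum_congr rfl fun ω _ => ?_
      rw [mul_add, ← Finset.sum_filter, Finset.sum_const, nsmul_eq_mul, mul_comm (W ω)]
      congr 1
      split_ifs <;> ring
    rw [this]
    have hs := Finset.sum_le_sum fun (i : Fin k) (_ : i ∈ Finset.univ) => shifted i
    rw [Finset.sum_const, Finset.card_univ, Fintype.card_fin, nsmul_eq_mul] at hs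
    have hb := mul_le_mul_of_nonneg_left base hk0.le
    have hfin : (2 * (k : ℝ) ^ 2 / M) ≤ 1 / 4 := by
      rw [div_le_div_iff₀ hM (by norm_num)]
      linarith
    nlinarith
  obtain ⟨ω, hωpos, hω⟩ : ∃ ω, 0 < W ω ∧ (((bad ω).card : ℝ) +
      k * (if g (z ∪ pairUnion Finset.univ ω) ≠ g z then 1 else 0)) ≤ k / 2 := by
    by_contra! hcon
    obtain ⟨ω₀, -, hω₀⟩ : ∃ ω ∈ (Finset.univ : Finset (Fin k → Finset α)), 0 < W ω := by
      by_contra! h0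
      have := Finset.sum_nonpos h0
      linarith
    have hlt : ∑ ω, W ω * ((k : ℝ) / 2) < ∑ ω, W ω * ((bad ω).card +
        k * (if g (z ∪ pairUnion Finset.univ ω) ≠ g z then 1 else 0)) := by
      refine Finset.sum_lt_sum (fun ω _ => ?_) ⟨ω₀, Finset.mem_univ _, ?_⟩
      · rcases (hW0 ω).eq_or_lt with h | h
        · simp [← h]
        · exact mul_le_mul_of_nonneg_left (hcon ω h).le h.le
      · exact mul_lt_mul_of_pos_left (hcon ω₀ hω₀) hω₀
    rw [← Finset.sum_mul, hW1, one_mul] at hlt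
    linarith
  have hbase : g (z ∪ pairUnion Finset.univ ω) = g z := by
    by_contra hne
    rw [if_pos hne] at hω
    have : (0 : ℝ) ≤ (bad ω).card := Nat.cast_nonneg _
    linarith
  have hbad : (bad ω).card ≤ m := by
    rw [if_neg (not_not.2 hbase), mul_zero, add_zero, hkR] at hω
    have : ((bad ω).card : ℝ) < m + 1 := by linarith
    exact Nat.lt_succ_iff.1 (by exact_mod_cast this)
  have hsup : ∀ i, ν (ω i) ≠ 0 := fun i hi => hωpos.ne' (by
    rw [hWdef]; exact Finset.prod_eq_zero (Finset.mem_univ i) hi)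
  -- Removing all pairwise intersections makes the blocks disjoint. Adding them to the base point
  -- restores what was removed, and for good `i` neither value of `g` has changed.
  have hgood := hm (z ∪ pairUnion Finset.univ ω) (bad ω)ᶜ
    (fun i => ω i \ pairUnion Finset.univ ω)
    (by
      intro i _ j _ hij
      rw [Finset.disjoint_left]
      intro e hi hj
      rw [Finset.mem_sdiff] at hi hj
      exact hi.2 (mem_pairUnion.2
        ⟨i, Finset.mem_univ i, j, Finset.mem_univ j, hij, hi.1, hj.1⟩))
    (by
      intro i hi
      have hi' : g (z ∪ ω i ∪ pairUnion (Finset.univ.erase i) ω) = g (z ∪ ω i) := by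
        by_contra h
        exact Finset.mem_compl.1 hi (Finset.mem_filter.2 ⟨Finset.mem_univ i, h⟩)
      have hset : z ∪ pairUnion Finset.univ ω ∪ ω i \ pairUnion Finset.univ ω
          = z ∪ ω i ∪ pairUnion (Finset.univ.erase i) ω := by
        ext e
        simp only [Finset.mem_union, Finset.mem_sdiff, mem_pairUnion, Finset.mem_univ, true_and,
          Finset.mem_erase, and_true]
        constructor
        · rintro ((h | ⟨j, l, hjl, hj, hl⟩) | ⟨h, -⟩)
          · exact Or.inl (Or.inl h)
          · by_cases hji : j = i
            · exact Or.inl (Or.inr (hji ▸ hj))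
            · by_cases hli : l = i
              · exact Or.inl (Or.inr (hli ▸ hl))
              · exact Or.inr ⟨j, hji, l, hli, hjl, hj, hl⟩
          · exact Or.inl (Or.inr h)
        · rintro ((h | h) | ⟨j, -, l, -, hjl, hj, hl⟩)
          · exact Or.inl (Or.inl h)
          · by_cases hw : ∃ j l, j ≠ l ∧ e ∈ ω j ∧ e ∈ ω l
            · exact Or.inl (Or.inr hw)
            · exact Or.inr ⟨h, hw⟩
          · exact Or.inl (Or.inr ⟨j, l, hjl, hj, hl⟩)
      rw [hset, hi', hbase]
      exact hνs _ (hsup i))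
  rw [Finset.card_compl, Fintype.card_fin] at hgood
  omega

theorem fracPackingBound_card (g : Finset α → Bool) :
    FracPackingBound g (Fintype.card α) := by
  intro y μ hμ hs hcov
  calc ∑ B, μ B ≤ ∑ B : Finset α, ∑ e, (if e ∈ B then μ B else 0) := by
        refine Finset.sum_le_sum fun B _ => ?_
        rcases B.eq_empty_or_nonempty with rfl | ⟨e, he⟩
        · have : μ ∅ = 0 := by
            by_contra h
            exact hs ∅ h (by simp)
          simp [this]
        · refine le_trans ?_ (Finset.single_le_sum (f := fun e => if e ∈ B then μ B else 0)
            (fun e _ => by split_ifs <;> simp [hμ]) (Finset.mem_univ e))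
          simp [he]
    _ = ∑ e, ∑ B : Finset α, (if e ∈ B then μ B else 0) := Finset.sum_comm
    _ ≤ ∑ _e : α, 1 := Finset.sum_le_sum fun e _ => hcov e
    _ = Fintype.card α := by simp

/-- Fractional packings of sensitive blocks are at most quadratically larger than integral
ones. -/
theorem fracPackingBound_of_card_le {g : Finset α → Bool} {m : ℕ}
    (hm : ∀ (y : Finset α) (G : Finset (Fin (2 * m + 1))) (B : Fin (2 * m + 1) → Finset α),
      (∀ i ∈ G, ∀ j ∈ G, i ≠ j → Disjoint (B i) (B j)) → (∀ i ∈ G, g (y ∪ B i) ≠ g y) →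
        G.card ≤ m) :
    FracPackingBound g (16 * (2 * m + 1) ^ 2) := by
  -- The supremum runs over all base points, because the sampling argument moves the base point. A
  -- packing above half the supremum suffices, so attainment is not needed.
  set V : Set ℝ := {M | ∃ (y : Finset α) (μ : Finset α → ℝ), (∀ B, 0 ≤ μ B) ∧
    (∀ B, μ B ≠ 0 → g (y ∪ B) ≠ g y) ∧ (∀ e, ∑ B, (if e ∈ B then μ B else 0) ≤ 1) ∧
      ∑ B, μ B = M} with hV
  have hbdd : BddAbove V := ⟨Fintype.card α, by
    rintro M ⟨y, μ, h₁, h₂, h₃, rfl⟩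
    exact fracPackingBound_card g y μ h₁ h₂ h₃⟩
  intro y μ h₁ h₂ h₃
  have hle : ∑ B, μ B ≤ sSup V := le_csSup hbdd ⟨y, μ, h₁, h₂, h₃, rfl⟩
  refine hle.trans ?_
  rcases le_or_gt (sSup V) 0 with h0 | h0
  · exact h0.trans (by positivity)
  have hne : V.Nonempty := ⟨_, y, μ, h₁, h₂, h₃, rfl⟩
  obtain ⟨M, ⟨z, ν, n₁, n₂, n₃, n₄⟩, hlt⟩ :=
    exists_lt_of_lt_csSup hne (half_lt_self h0)
  have hM := lt_of_near_optimal hm (by linarith : 0 < M)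
    (fun y' μ' a₁ a₂ a₃ => (le_csSup hbdd ⟨y', μ', a₁, a₂, a₃, rfl⟩).trans (by linarith))
    z ν n₁ n₂ n₃ n₄
  linarith

end Sampling

/-! ### Rank of protocol matrices -/

section Rank

theorem Matrix.rank_add_le {m n : Type} [Fintype m] [Fintype n] (A B : Matrix m n ℝ) :
    (A + B).rank ≤ A.rank + B.rank := by
  unfold Matrix.rank
  rw [Matrix.mulVecLin_add]
  exact (Submodule.finrank_mono (LinearMap.range_add_le _ _)).trans
    (Submodule.finrank_add_le_finrank_add_finrank _ _)

/-- The matrix of a protocol, with weights on rows and columns, has rank at most two to the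
cost. -/
theorem Protocol.rank_le {X Y : Type} [Fintype X] [Fintype Y] (P : Protocol X Y) :
    ∀ (A : X → ℝ) (B : Y → ℝ), (Matrix.of fun x y =>
      A x * B y * (if P.eval x y = true then (1 : ℝ) else 0)).rank ≤ 2 ^ P.cost := by
  induction P with
  | leaf v =>
    intro A B
    have : (Matrix.of fun x y => A x * B y *
        (if (leaf v : Protocol X Y).eval x y = true then (1 : ℝ) else 0)) =
        Matrix.vecMulVec A (fun y => B y * if v = true then 1 else 0) := by
      ext x y
      simp only [eval, Matrix.of_apply, Matrix.vecMulVec_apply, mul_assoc]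
      rfl
    rw [this]
    exact Matrix.rank_vecMulVec_le _ _
  | alice a p₀ p₁ ih₀ ih₁ =>
    intro A B
    -- Zero row weights restrict the matrix to the inputs for which Alice sends the given bit.
    have e₀ := ih₀ (fun x => if a x = true then 0 else A x) B
    have e₁ := ih₁ (fun x => if a x = true then A x else 0) B
    have m₀ := Nat.pow_le_pow_right (n := 2) (by norm_num) (le_max_left p₀.cost p₁.cost)
    have m₁ := Nat.pow_le_pow_right (n := 2) (by norm_num) (le_max_right p₀.cost p₁.cost)
    have e := Matrix.rank_add_le (Matrix.of fun x y => (if a x = true then 0 else A x) * B y *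
      (if p₀.eval x y = true then (1 : ℝ) else 0)) (Matrix.of fun x y =>
        (if a x = true then A x else 0) * B y * (if p₁.eval x y = true then (1 : ℝ) else 0))
    have : (Matrix.of fun x y => A x * B y *
        (if (alice a p₀ p₁).eval x y = true then (1 : ℝ) else 0)) =
        (Matrix.of fun x y => (if a x = true then 0 else A x) * B y *
          (if p₀.eval x y = true then (1 : ℝ) else 0)) +
        (Matrix.of fun x y => (if a x = true then A x else 0) * B y *
          (if p₁.eval x y = true then (1 : ℝ) else 0)) := by
      ext x y
      simp only [eval, Matrix.of_apply, Matrix.add_apply]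
      by_cases h : a x = true <;> simp [h]
    rw [this, cost, pow_succ]
    omega
  | bob b p₀ p₁ ih₀ ih₁ =>
    intro A B
    have e₀ := ih₀ A (fun y => if b y = true then 0 else B y)
    have e₁ := ih₁ A (fun y => if b y = true then B y else 0)
    have m₀ := Nat.pow_le_pow_right (n := 2) (by norm_num) (le_max_left p₀.cost p₁.cost)
    have m₁ := Nat.pow_le_pow_right (n := 2) (by norm_num) (le_max_right p₀.cost p₁.cost)
    have e := Matrix.rank_add_le (Matrix.of fun x y => A x * (if b y = true then 0 else B y) *
      (if p₀.eval x y = true then (1 : ℝ) else 0)) (Matrix.of fun x y =>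
        A x * (if b y = true then B y else 0) * (if p₁.eval x y = true then (1 : ℝ) else 0))
    have : (Matrix.of fun x y => A x * B y *
        (if (bob b p₀ p₁).eval x y = true then (1 : ℝ) else 0)) =
        (Matrix.of fun x y => A x * (if b y = true then 0 else B y) *
          (if p₀.eval x y = true then (1 : ℝ) else 0)) +
        (Matrix.of fun x y => A x * (if b y = true then B y else 0) *
          (if p₁.eval x y = true then (1 : ℝ) else 0)) := by
      ext x y
      simp only [eval, Matrix.of_apply, Matrix.add_apply]
      by_cases h : b y = true <;> simp [h]
    rw [this, cost, pow_succ]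
    omega

end Rank

/-! ### Multilinear coefficients and a popular variable -/

section Polynomial

variable {α : Type}

/-- `a` is the family of coefficients of the multilinear polynomial of the set function `g`. -/
def IsCoeff (g : Finset α → Bool) (a : Finset α → ℝ) : Prop :=
  ∀ T, (if g T = true then (1 : ℝ) else 0) = ∑ S ∈ T.powerset, a S

theorem eq_zero_of_sum_powerset_eq_zero {a : Finset α → ℝ} (T : Finset α)
    (h : ∀ S ⊆ T, ∑ U ∈ S.powerset, a U = 0) : a T = 0 := by
  induction T using Finset.strongInduction with
  | H T ih =>
    have := h T subset_rfl
    rwa [Finset.sum_eq_single_of_mem T (Finset.mem_powerset_self T) fun S hS hne =>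
      ih S ((Finset.mem_powerset.1 hS).ssubset_of_ne hne) fun U hU =>
        h U (hU.trans (Finset.mem_powerset.1 hS))] at this

open Classical in
/-- The nonempty monomials with a nonzero coefficient. -/
noncomputable def monomials [Fintype α] (a : Finset α → ℝ) : Finset (Finset α) :=
  Finset.univ.filter fun S => S.Nonempty ∧ a S ≠ 0

theorem mem_monomials [Fintype α] {a : Finset α → ℝ} {S : Finset α} :
    S ∈ monomials a ↔ S.Nonempty ∧ a S ≠ 0 := by simp [monomials]

variable [DecidableEq α]

theorem exists_isCoeff (g : Finset α → Bool) : ∃ a, IsCoeff g a := by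
  let a : Finset α → ℝ := fun S => Finset.strongInduction
    (fun T ih => (if g T = true then (1 : ℝ) else 0) -
      ∑ S : T.ssubsets, ih S.1 (Finset.mem_ssubsets.1 S.2)) S
  refine ⟨a, fun T => ?_⟩
  have h : a T = (if g T = true then (1 : ℝ) else 0) - ∑ S : T.ssubsets, a S.1 :=
    Finset.strongInduction_eq _ _
  rw [Finset.sum_coe_sort T.ssubsets a] at h
  rw [Finset.ssubsets, Finset.sum_erase_eq_sub (Finset.mem_powerset_self T)] at h
  linarith

/-- A nonempty monomial contains a block which is sensitive at the empty set. -/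
theorem IsCoeff.exists_sensitive {g : Finset α → Bool} {a : Finset α → ℝ} (h : IsCoeff g a)
    {S : Finset α} (hS : S.Nonempty) (ha : a S ≠ 0) : ∃ B ⊆ S, g (∅ ∪ B) ≠ g ∅ := by
  by_contra! hcon
  refine ha ?_
  -- If `g` is constant on subsets of `S`, the coefficients without the constant term have zero sums
  -- below `S`, hence vanish there.
  have := eq_zero_of_sum_powerset_eq_zero (a := fun U => if U = ∅ then 0 else a U) S
    (fun T hT => by
      have h₁ := h T
      have h₂ := h ∅
      rw [← Finset.empty_union T, hcon T hT, h₂, Finset.empty_union,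
        ← Finset.add_sum_erase _ _ (Finset.empty_mem_powerset T)] at h₁
      rw [← Finset.add_sum_erase _ _ (Finset.empty_mem_powerset T), if_pos rfl, zero_add]
      rw [Finset.sum_congr rfl fun U hU => if_neg (Finset.ne_of_mem_erase hU)]
      rw [Finset.powerset_empty, Finset.sum_singleton] at h₁
      linarith)
  simpa [hS.ne_empty] using this

/-- Fixing the elements of `I` to be present. -/
theorem IsCoeff.union {g : Finset α → Bool} {a : Finset α → ℝ} (h : IsCoeff g a)
    (I : Finset α) : IsCoeff (fun T => g (T ∪ I))
      (fun S => if Disjoint S I then ∑ J ∈ I.powerset, a (S ∪ J) else 0) := by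
  intro T
  rw [h (T ∪ I), ← Finset.sum_filter, ← Finset.sum_product']
  refine Finset.sum_bij' (fun U _ => (U \ I, U ∩ I)) (fun q _ => q.1 ∪ q.2) ?_ ?_ ?_ ?_ ?_
  · intro U hU
    rw [Finset.mem_powerset] at hU
    simp only [Finset.mem_product, Finset.mem_filter, Finset.mem_powerset]
    exact ⟨⟨sdiff_le_iff.2 (by rwa [Finset.sup_eq_union, Finset.union_comm]), Finset.sdiff_disjoint⟩,
      Finset.inter_subset_right⟩
  · rintro ⟨S, J⟩ hq
    simp only [Finset.mem_product, Finset.mem_filter, Finset.mem_powerset] at hq ⊢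
    exact Finset.union_subset_union hq.1.1 hq.2
  · intro U _
    exact Finset.sdiff_union_inter U I
  · rintro ⟨S, J⟩ hq
    simp only [Finset.mem_product, Finset.mem_filter, Finset.mem_powerset] at hq
    obtain ⟨⟨-, hd⟩, hJ⟩ := hq
    rw [Finset.union_sdiff_distrib, Finset.sdiff_eq_empty_iff_subset.2 hJ,
      Finset.sdiff_eq_self_of_disjoint hd, Finset.union_empty, Finset.union_inter_distrib_right,
      Finset.disjoint_iff_inter_eq_empty.1 hd, Finset.inter_eq_left.2 hJ, Finset.empty_union]
  · intro U _
    rw [Finset.sdiff_union_inter]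

/-- Fixing the element `i` to be absent. -/
theorem IsCoeff.erase {g : Finset α → Bool} {a : Finset α → ℝ} (h : IsCoeff g a) (i : α) :
    IsCoeff (fun T => g (T.erase i)) (fun S => if i ∈ S then 0 else a S) := by
  intro T
  have hT : (T.erase i).powerset = T.powerset.filter fun S => i ∉ S := by
    ext S
    simp only [Finset.mem_powerset, Finset.mem_filter, Finset.subset_erase]
  rw [h (T.erase i), hT, Finset.sum_filter]
  exact Finset.sum_congr rfl fun S _ => ite_not _ _ _

variable [Fintype α]

theorem IsCoeff.eq_of_monomials_eq_empty {g : Finset α → Bool} {a : Finset α → ℝ}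
    (h : IsCoeff g a) (ha : monomials a = ∅) (T : Finset α) : g T = g ∅ := by
  have hz : ∀ S : Finset α, S.Nonempty → a S = 0 := fun S hS => by
    by_contra h0
    simpa [ha] using mem_monomials.2 ⟨hS, h0⟩
  have h₁ := h T
  rw [← Finset.add_sum_erase _ _ (Finset.empty_mem_powerset T), Finset.sum_eq_zero fun S hS =>
    hz S (Finset.nonempty_iff_ne_empty.2 (Finset.ne_of_mem_erase hS))] at h₁
  have h₂ := h ∅
  rw [Finset.powerset_empty, Finset.sum_singleton] at h₂
  rw [add_zero, ← h₂] at h₁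
  cases hT : g T <;> cases h0 : g ∅ <;> simp [hT, h0] at h₁ ⊢

theorem card_monomials_union_le (a : Finset α → ℝ) (I : Finset α) :
    (monomials fun S => if Disjoint S I then ∑ J ∈ I.powerset, a (S ∪ J) else 0).card
      ≤ (monomials a).card := by
  classical
  -- Every surviving monomial is an old one with the variables of `I` deleted; merging and
  -- cancellation only lower the count.
  refine Finset.card_le_card_of_surjOn (fun U => U \ I) ?_
  intro S hS
  obtain ⟨hne, h0⟩ := mem_monomials.1 (Finset.mem_coe.1 hS)
  have hd : Disjoint S I := by
    by_contra h
    simp [h] at h0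
  rw [if_pos hd] at h0
  obtain ⟨J, hJ, hJ0⟩ := Finset.exists_ne_zero_of_sum_ne_zero h0
  refine ⟨S ∪ J, Finset.mem_coe.2 (mem_monomials.2 ⟨hne.mono Finset.subset_union_left, hJ0⟩), ?_⟩
  simp only
  rw [Finset.union_sdiff_distrib, Finset.sdiff_eq_empty_iff_subset.2 (Finset.mem_powerset.1 hJ),
    Finset.sdiff_eq_self_of_disjoint hd, Finset.union_empty]

theorem card_monomials_erase (a : Finset α → ℝ) (i : α) :
    (monomials fun S => if i ∈ S then 0 else a S).card
      + ((monomials a).filter fun S => i ∈ S).card = (monomials a).card := by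
  classical
  rw [← Finset.card_filter_add_card_filter_not (s := monomials a) (fun S => i ∈ S), add_comm]
  congr 2
  ext S
  by_cases hi : i ∈ S <;> simp [mem_monomials, hi]

/-- The number of monomials is at most exponential in the communication cost of the
AND-function. -/
theorem HasAndCost.card_monomials_le {g : Finset α → Bool} {C : ℕ} (h : HasAndCost g C)
    {a : Finset α → ℝ} (ha : IsCoeff g a) : (monomials a).card ≤ 2 ^ C := by
  classical
  obtain ⟨P, hP, hc⟩ := h
  let Z : Matrix (Finset α) (Finset α) ℝ := Matrix.of fun T S => if S ⊆ T then 1 else 0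
  have hZ : IsUnit Z := by
    rw [← Matrix.mulVec_injective_iff_isUnit]
    refine (injective_iff_map_eq_zero (Matrix.mulVecLin Z)).2 fun b hb => funext fun T => ?_
    refine eq_zero_of_sum_powerset_eq_zero T fun S _ => ?_
    have := congrFun hb S
    rw [Matrix.mulVecLin_apply, Matrix.mulVec, dotProduct, Pi.zero_apply] at this
    rw [← this, ← Finset.filter_subset_univ S, Finset.sum_filter]
    simp [Z]
  have hdet : IsUnit Z.det := (Matrix.isUnit_iff_isUnit_det Z).1 hZ
  have hfac : (Matrix.of fun x y => (1 : ℝ) * 1 * (if P.eval x y = true then (1 : ℝ) else 0))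
      = Z * Matrix.diagonal a * Z.transpose := by
    ext x y
    simp only [mul_one, one_mul, Matrix.of_apply]
    rw [hc x y, ha (x ∩ y), Matrix.mul_apply, ← Finset.filter_subset_univ, Finset.sum_filter]
    refine Finset.sum_congr rfl fun S _ => ?_
    rw [Matrix.mul_diagonal]
    simp only [Z, Matrix.of_apply, Matrix.transpose_apply, Finset.subset_inter_iff]
    by_cases hx : S ⊆ x <;> by_cases hy : S ⊆ y <;> simp [hx, hy]
  have hr := P.rank_le (fun _ => 1) (fun _ => 1)
  rw [hfac, Matrix.rank_mul_eq_left_of_isUnit_det _ _ (by rwa [Matrix.det_transpose]),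
    Matrix.rank_mul_eq_right_of_isUnit_det _ _ hdet, Matrix.rank_diagonal,
    Fintype.card_subtype] at hr
  refine (Finset.card_le_card fun S hS => ?_).trans
    (hr.trans (Nat.pow_le_pow_right (by norm_num) hP))
  simp [(mem_monomials.1 hS).2]

/-- Some element lies in a large fraction of the monomials. -/
theorem HasAndCost.exists_popular {g : Finset α → Bool} {C : ℕ} (h : HasAndCost g C)
    {a : Finset α → ℝ} (ha : IsCoeff g a) (hne : (monomials a).Nonempty) :
    ∃ i, ((monomials a).card : ℝ)
      ≤ 16 * (4 * C + 1) ^ 2 * ((monomials a).filter fun S => i ∈ S).card := by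
  classical
  have hbound : FracPackingBound g (16 * (2 * (2 * C : ℕ) + 1) ^ 2) :=
    fracPackingBound_of_card_le fun y G B hB hs => h.card_le_of_sensitive y G B hB hs
  obtain ⟨S₀, hS₀⟩ := hne
  obtain ⟨i₀, hi₀⟩ := (mem_monomials.1 hS₀).1
  obtain ⟨i, -, hi⟩ := Finset.exists_max_image Finset.univ
    (fun i => ((monomials a).filter fun S => i ∈ S).card) ⟨i₀, Finset.mem_univ i₀⟩
  refine ⟨i, ?_⟩
  have hpos : 0 < ((monomials a).filter fun S => i ∈ S).card :=
    lt_of_lt_of_le (Finset.card_pos.2 ⟨S₀, Finset.mem_filter.2 ⟨hS₀, hi₀⟩⟩)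
      (hi i₀ (Finset.mem_univ i₀))
  choose! B hBS hB using fun S (hS : S ∈ monomials a) =>
    ha.exists_sensitive (mem_monomials.1 hS).1 (mem_monomials.1 hS).2
  -- Each monomial gives weight one to its block. A point is covered at most as often as it occurs
  -- in monomials, so the largest such count serves as `c`.
  have := hbound.sum_le (Ω := monomials a) ∅ (fun _ => 1) (fun _ => zero_le_one)
    (fun S => B S.1) (c := ((monomials a).filter fun S => i ∈ S).card) (by exact_mod_cast hpos)
    (fun e => by
      refine le_trans ?_ (Nat.cast_le.2 (hi e (Finset.mem_univ e)))
      rw [Finset.sum_coe_sort (monomials a) (fun S => if e ∈ B S then (1 : ℝ) else 0),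
        Finset.sum_boole]
      exact Nat.cast_le.2 (Finset.card_le_card fun S hS => by
        rw [Finset.mem_filter] at hS ⊢
        exact ⟨hS.1, hBS S hS.1 hS.2⟩))
  rw [Finset.sum_coe_sort (monomials a) (fun S => if g (∅ ∪ B S) ≠ g ∅ then (1 : ℝ) else 0),
    Finset.sum_congr rfl fun S hS => if_pos (hB S hS), Finset.sum_const, nsmul_eq_mul,
    mul_one] at this
  refine this.trans (le_of_eq ?_)
  push_cast
  ring

end Polynomial

/-! ### Finding the first zero by binary search -/

namespace AndDecisionTree

variable {n : ℕ}

/-- The output of the tree on the indicator vector of a set. -/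
def evalSet (T : AndDecisionTree n) (z : Finset (Fin n)) : Bool :=
  T.eval fun i => decide (i ∈ z)

theorem evalSet_leaf (v : Bool) (z : Finset (Fin n)) : (leaf v).evalSet z = v := rfl

theorem evalSet_query (S : Finset (Fin n)) (T₀ T₁ : AndDecisionTree n) (z : Finset (Fin n)) :
    (query S T₀ T₁).evalSet z = if S ⊆ z then T₁.evalSet z else T₀.evalSet z := by
  simp only [evalSet, eval, decide_eq_true_eq, Finset.subset_iff]

/-- Binary search along a chain of conjunctions. -/
theorem exists_binarySearch {g : Finset (Fin n) → Bool} {d : ℕ} (S : ℕ → Finset (Fin n))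
    (h : ∀ t, ∃ T : AndDecisionTree n, T.depth ≤ d ∧
      ∀ z, S t ⊆ z → ¬S (t + 1) ⊆ z → T.evalSet z = g z) (k : ℕ) : ∀ t,
    ∃ T : AndDecisionTree n, T.depth ≤ d + k ∧
      ∀ z, S t ⊆ z → ¬S (t + 2 ^ k) ⊆ z → T.evalSet z = g z := by
  induction k with
  | zero => simpa using h
  | succ k ih =>
    intro t
    obtain ⟨T₀, d₀, h₀⟩ := ih t
    obtain ⟨T₁, d₁, h₁⟩ := ih (t + 2 ^ k)
    refine ⟨query (S (t + 2 ^ k)) T₀ T₁, ?_, fun z hz hz' => ?_⟩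
    · simp only [depth]
      omega
    · rw [evalSet_query]
      split_ifs with hS
      · exact h₁ z hS (by rwa [add_assoc, ← two_mul, ← pow_succ'])
      · exact h₀ z hz hS

/-- If setting any initial run of ones followed by a zero leaves a problem of depth `d`, then
the first zero is found at a logarithmic extra cost. -/
theorem exists_of_forall_step {g : Finset (Fin n) → Bool} {d : ℕ}
    (h : ∀ I : Finset (Fin n), (∃ v, ∀ z, I ⊆ z → g z = v) ∨
      ∃ i, i ∉ I ∧ ∃ T : AndDecisionTree n, T.depth ≤ d ∧
        ∀ z, I ⊆ z → i ∉ z → T.evalSet z = g z) :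
    ∃ T : AndDecisionTree n, T.depth ≤ d + Nat.clog 2 n + 1 ∧ ∀ z, T.evalSet z = g z := by
  have step : ∀ I : Finset (Fin n), ∃ J, I ⊆ J ∧
      ((∃ v, ∀ z, I ⊆ z → g z = v) ∨ I.card + 1 ≤ J.card) ∧
      ∃ T : AndDecisionTree n, T.depth ≤ d ∧ ∀ z, I ⊆ z → ¬J ⊆ z → T.evalSet z = g z := by
    intro I
    rcases h I with hv | ⟨i, hi, T, hT, hz⟩
    -- Once `g` is constant above `I` the chain may stall: no input lies between `I` and itself, so
    -- any tree will do.
    · exact ⟨I, subset_rfl, Or.inl hv, leaf false, Nat.zero_le _, fun z h₁ h₂ => absurd h₁ h₂⟩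
    · refine ⟨insert i I, Finset.subset_insert _ _,
        Or.inr (Finset.card_insert_of_notMem hi).ge, T, hT, fun z h₁ h₂ => hz z h₁ fun h₃ => ?_⟩
      exact h₂ (Finset.insert_subset h₃ h₁)
  choose next hsub hcard htree using step
  let S : ℕ → Finset (Fin n) := fun t => next^[t] ∅
  have hS : ∀ t, S (t + 1) = next (S t) := fun t => Function.iterate_succ_apply' next t ∅
  have hconst : ∀ t, (∃ v, ∀ z, S t ⊆ z → g z = v) ∨ t ≤ (S t).card := by
    intro t
    induction t with
    | zero => exact Or.inr (Nat.zero_le _)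
    | succ t ih =>
      rw [hS]
      rcases hcard (S t) with ⟨v, hv⟩ | hc
      · exact Or.inl ⟨v, fun z hz => hv z ((hsub _).trans hz)⟩
      · rcases ih with ⟨v, hv⟩ | ih
        · exact Or.inl ⟨v, fun z hz => hv z ((hsub _).trans hz)⟩
        · exact Or.inr (by omega)
  -- After at least `n` steps the chain has either reached a constant restriction or exhausted all
  -- variables.
  obtain ⟨v, hv⟩ : ∃ v, ∀ z, S (0 + 2 ^ Nat.clog 2 n) ⊆ z → g z = v := by
    rcases hconst (0 + 2 ^ Nat.clog 2 n) with hv | hc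
    · exact hv
    · have hn : n ≤ 2 ^ Nat.clog 2 n := Nat.le_pow_clog (by norm_num) n
      have huniv : S (0 + 2 ^ Nat.clog 2 n) = Finset.univ := by
        rw [← Finset.card_eq_iff_eq_univ, Fintype.card_fin]
        refine le_antisymm ((Finset.card_le_univ _).trans (Fintype.card_fin n).le) ?_
        omega
      rw [huniv]
      exact ⟨g Finset.univ, fun z hz => by rw [Finset.univ_subset_iff.1 hz]⟩
  obtain ⟨T, hT, hz⟩ := exists_binarySearch S (fun t => by rw [hS]; exact htree (S t))
    (Nat.clog 2 n) 0
  refine ⟨query (S (0 + 2 ^ Nat.clog 2 n)) T (leaf v), ?_, fun z => ?_⟩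
  · simp only [depth]
    omega
  · rw [evalSet_query]
    split_ifs with h₁
    · rw [evalSet_leaf, hv z h₁]
    · exact hz z (Finset.empty_subset z) h₁

end AndDecisionTree

/-! ### Iterating the rounds and the final count -/

/-- Each round of queries removes a fixed fraction of the monomials. -/
theorem HasAndCost.exists_tree {n C : ℕ} {L : ℝ} (hL : L = 16 * (4 * C + 1) ^ 2) (r : ℕ) :
    ∀ (g : Finset (Fin n) → Bool) (a : Finset (Fin n) → ℝ), HasAndCost g C → IsCoeff g a →
      ((monomials a).card : ℝ) * (1 - 1 / L) ^ r < 1 →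
      ∃ T : AndDecisionTree n, T.depth ≤ r * (Nat.clog 2 n + 1) ∧ ∀ z, T.evalSet z = g z := by
  have hLpos : 0 < L := hL ▸ by positivity
  have hL1 : 1 ≤ L := by
    rw [hL]
    nlinarith [(Nat.cast_nonneg C : (0 : ℝ) ≤ C)]
  have hq : 0 ≤ 1 - 1 / L := sub_nonneg.2 ((div_le_one hLpos).2 hL1)
  induction r with
  | zero =>
    intro g a _ ha hlt
    rw [pow_zero, mul_one, Nat.cast_lt_one, Finset.card_eq_zero] at hlt
    exact ⟨.leaf (g ∅), Nat.zero_le _, fun z => (ha.eq_of_monomials_eq_empty hlt z).symm⟩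
  | succ r ih =>
    intro g a hg ha hlt
    obtain ⟨T, hT, hz⟩ := AndDecisionTree.exists_of_forall_step (g := g)
      (d := r * (Nat.clog 2 n + 1)) (fun I => by
        set b : Finset (Fin n) → ℝ :=
          fun S => if Disjoint S I then ∑ J ∈ I.powerset, a (S ∪ J) else 0 with hb
        have hbI : IsCoeff (fun T => g (T ∪ I)) b := ha.union I
        have hba : ((monomials b).card : ℝ) ≤ (monomials a).card :=
          Nat.cast_le.2 (card_monomials_union_le a I)
        have hgI : HasAndCost (fun T => g (T ∪ I)) C :=
          hg.comp (· ∪ I) fun x y => Finset.inter_union_distrib_right x y I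
        rcases (monomials b).eq_empty_or_nonempty with he | hne
        · refine Or.inl ⟨g (∅ ∪ I), fun z hz => ?_⟩
          have := hbI.eq_of_monomials_eq_empty he z
          simpa only [Finset.union_eq_left.2 hz] using this
        · obtain ⟨i, hi⟩ := hgI.exists_popular hbI hne
          rw [← hL] at hi
          have hpos : 0 < ((monomials b).filter fun S => i ∈ S).card := by
            by_contra h0
            rw [Nat.eq_zero_of_not_pos h0, Nat.cast_zero, mul_zero] at hi
            exact hne.card_pos.ne' (by exact_mod_cast le_antisymm hi (Nat.cast_nonneg _))
          obtain ⟨S, hS⟩ := Finset.card_pos.1 hpos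
          rw [Finset.mem_filter] at hS
          have hiI : i ∉ I := fun h => (mem_monomials.1 hS.1).2
            (if_neg (Finset.not_disjoint_iff.2 ⟨i, hS.2, h⟩))
          have hcard : ((monomials fun S => if i ∈ S then 0 else b S).card : ℝ)
              ≤ (monomials a).card * (1 - 1 / L) := by
            have h₁ : ((monomials fun S => if i ∈ S then 0 else b S).card : ℝ)
                + ((monomials b).filter fun S => i ∈ S).card = (monomials b).card := by
              exact_mod_cast card_monomials_erase b i
            have h₂ : ((monomials b).card : ℝ) / L
                ≤ ((monomials b).filter fun S => i ∈ S).card := by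
              rwa [div_le_iff₀' hLpos]
            calc _ ≤ ((monomials b).card : ℝ) * (1 - 1 / L) := by
                  rw [mul_sub, mul_one_div]
                  linarith
              _ ≤ _ := mul_le_mul_of_nonneg_right hba hq
          -- This restriction agrees with `g` on inputs containing `I` and missing `i`, and still
          -- has a protocol of cost `C`.
          obtain ⟨T, hT, hz⟩ := ih (fun T => g (T.erase i ∪ I))
            (fun S => if i ∈ S then 0 else b S)
            (hgI.comp (fun T => T.erase i) fun x y => by ext; simp; tauto)
            (hbI.erase i)
            (lt_of_le_of_lt (mul_le_mul_of_nonneg_right hcard (pow_nonneg hq r))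
              (by rwa [mul_assoc, ← pow_succ']))
          refine Or.inr ⟨i, hiI, T, hT, fun z hIz hiz => ?_⟩
          rw [hz, Finset.erase_eq_of_notMem hiz, Finset.union_eq_left.2 hIz])
    exact ⟨T, hT.trans (le_of_eq (by ring)), hz⟩

/-- The set function of a boolean function. -/
def toSetFunction {n : ℕ} (f : (Fin n → Bool) → Bool) (S : Finset (Fin n)) : Bool :=
  f fun i => decide (i ∈ S)

theorem hasAndCost_toSetFunction {n : ℕ} (f : (Fin n → Bool) → Bool) :
    HasAndCost (toSetFunction f) (commComplexity (andFunction f)) := by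
  obtain ⟨P, hP, hc⟩ : ∃ P : Protocol (Fin n → Bool) (Fin n → Bool),
      P.Computes (andFunction f) ∧ P.cost = commComplexity (andFunction f) := by
    classical
    exact Nat.find_spec (Protocol.exists_cost (andFunction f))
  refine ⟨P.comap (fun S i => decide (i ∈ S)) (fun S i => decide (i ∈ S)), ?_, fun x y => ?_⟩
  · rw [Protocol.cost_comap, hc]
  · rw [Protocol.eval_comap, hP]
    simp [andFunction, toSetFunction]

theorem andDTComplexity_le {n : ℕ} {f : (Fin n → Bool) → Bool} (T : AndDecisionTree n)
    (hT : ∀ z, T.evalSet z = toSetFunction f z) : andDTComplexity f ≤ T.depth := by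
  classical
  refine Nat.find_min' (AndDecisionTree.exists_depth f) ⟨T, fun z => ?_, rfl⟩
  have := hT (Finset.univ.filter fun i => z i = true)
  simpa [AndDecisionTree.evalSet, toSetFunction] using this

/-- A protocol of cost zero is a leaf, so `f` is constant. The decay estimate of the main proof
needs `C ≥ 1`. -/
theorem andDTComplexity_eq_zero {n : ℕ} {f : (Fin n → Bool) → Bool}
    (h : commComplexity (andFunction f) = 0) : andDTComplexity f = 0 := by
  obtain ⟨P, hP, hc⟩ := hasAndCost_toSetFunction f
  rw [h, Nat.le_zero] at hP
  cases P with
  | leaf v =>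
    refine Nat.le_zero.1 (andDTComplexity_le (.leaf v) fun z => ?_)
    have := hc z z
    simp only [Finset.inter_self] at this
    exact this
  | alice a p₀ p₁ => simp [Protocol.cost] at hP
  | bob b p₀ p₁ => simp [Protocol.cost] at hP

theorem clog_add_one_le {n : ℕ} (hn : 2 ≤ n) :
    ((Nat.clog 2 n + 1 : ℕ) : ℝ) ≤ 3 * Real.logb 2 n := by
  have h₁ : (1 : ℝ) ≤ Real.logb 2 n := by
    rw [Real.le_logb_iff_rpow_le (by norm_num) (by positivity), Real.rpow_one]
    exact_mod_cast hn
  have h₂ : ((Nat.clog 2 n : ℕ) : ℝ) ≤ Real.logb 2 n + 1 := by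
    have hlt : 2 ^ (Nat.clog 2 n - 1) < n := Nat.pow_pred_clog_lt_self (by norm_num) (by omega)
    have hpos : 0 < Nat.clog 2 n := Nat.clog_pos (by norm_num) (by omega)
    have : ((Nat.clog 2 n - 1 : ℕ) : ℝ) ≤ Real.logb 2 n := by
      rw [Real.le_logb_iff_rpow_le (by norm_num) (by positivity), Real.rpow_natCast]
      exact_mod_cast hlt.le
    rw [Nat.cast_sub hpos, Nat.cast_one] at this
    linarith
  push_cast
  linarith

theorem mainTheorem3 :
    ∃ K : ℝ, 0 < K ∧ ∀ n : ℕ, 2 ≤ n → ∀ f : (Fin n → Bool) → Bool,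
      (andDTComplexity f : ℝ) ≤
        K * (commComplexity (andFunction f) : ℝ) ^ 3 * Real.logb 2 (n : ℝ) := by
  refine ⟨1200, by norm_num, fun n hn f => ?_⟩
  rcases Nat.eq_zero_or_pos (commComplexity (andFunction f)) with h0 | hpos
  · rw [andDTComplexity_eq_zero h0, h0]
    simp
  set C := commComplexity (andFunction f) with hC
  have hg : HasAndCost (toSetFunction f) C := hasAndCost_toSetFunction f
  obtain ⟨a, ha⟩ := exists_isCoeff (toSetFunction f)
  have hC1 : (1 : ℝ) ≤ C := by exact_mod_cast hpos
  -- Since `4 * C + 1 ≤ 5 * C`, the loss parameter is at most `400 * C ^ 2`. Hence `400 * C ^ 3`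
  -- rounds shrink the count by `exp (-C)`, which beats `2 ^ C` because `2 < e`.
  have hdecay : ((monomials a).card : ℝ) * (1 - 1 / (16 * (4 * C + 1) ^ 2)) ^ (400 * C ^ 3) < 1 := by
    have hL : (16 * (4 * C + 1) ^ 2 : ℝ) ≤ 400 * C ^ 2 := by nlinarith
    have hq : (0 : ℝ) ≤ 1 - 1 / (16 * (4 * C + 1) ^ 2) := by
      rw [sub_nonneg, div_le_one (by positivity)]
      nlinarith
    have h₁ : (1 : ℝ) - 1 / (16 * (4 * C + 1) ^ 2) ≤ Real.exp (-(1 / (400 * C ^ 2))) := by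
      refine le_trans ?_ (Real.add_one_le_exp _)
      have := one_div_le_one_div_of_le (by positivity) hL
      linarith
    have h₂ : ((1 : ℝ) - 1 / (16 * (4 * C + 1) ^ 2)) ^ (400 * C ^ 3) ≤ Real.exp (-1) ^ C := by
      refine (pow_le_pow_left₀ hq h₁ _).trans (le_of_eq ?_)
      rw [← Real.exp_nat_mul, ← Real.exp_nat_mul]
      congr 1
      push_cast
      field_simp
    have h₃ : ((monomials a).card : ℝ) ≤ 2 ^ C := by exact_mod_cast hg.card_monomials_le ha
    have h₄ : 2 * Real.exp (-1) < 1 := by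
      rw [Real.exp_neg, ← div_eq_mul_inv, div_lt_one (Real.exp_pos 1)]
      exact lt_trans (by norm_num) Real.exp_one_gt_d9
    calc _ ≤ 2 ^ C * Real.exp (-1) ^ C := mul_le_mul h₃ h₂ (pow_nonneg hq _) (by positivity)
      _ = (2 * Real.exp (-1)) ^ C := (mul_pow _ _ _).symm
      _ < 1 := pow_lt_one₀ (by positivity) h₄ hpos.ne'
  obtain ⟨T, hT, hz⟩ := HasAndCost.exists_tree rfl (400 * C ^ 3) _ a hg ha hdecay
  calc (andDTComplexity f : ℝ) ≤ (400 * C ^ 3 * (Nat.clog 2 n + 1) : ℕ) :=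
        Nat.cast_le.2 ((andDTComplexity_le T hz).trans hT)
    _ = 400 * C ^ 3 * ((Nat.clog 2 n + 1 : ℕ) : ℝ) := by push_cast; ring
    _ ≤ 400 * C ^ 3 * (3 * Real.logb 2 n) :=
        mul_le_mul_of_nonneg_left (clog_add_one_le hn) (by positivity)
    _ = 1200 * C ^ 3 * Real.logb 2 n := by ring
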